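/- Let $\{\alpha_n\}_{n=0}^\infty\subset\mathbb D=\{|z|<1\}$ be Verblunsky coefficients with $$\sum_{n=0}^\infty|\alpha_{n+1}-\alpha_n|<\infty\quad\text{and}\quad \alpha_n\to 0 .$$ Let $\varphi_n$ be the orthonormal polynomials on the unit circle that they define, $\varphi_0=1$ and $\varphi_{n+1}(z)=(1-|\alpha_n|^2)^{-1/2}\bigl(z\varphi_n(z)-\bar\alpha_n\varphi_n^*(z)\bigr)$, where $\varphi_n^*(z)=z^n\,\overline{\varphi_n(1/\bar z)}$. For any choice of $\beta_n\in\partial\mathbb D$, $n\ge1$ (for instance $\beta_n=\beta$ for all $n$), let $$\tilde\varphi_n(z)=z\varphi_{n-1}(z)-\bar\beta_n\varphi_{n-1}^*(z),\qquad n\ge 1,$$ be the paraorthogonal polynomials. Then their zeros have uniform clock behavior on every compact set $K\subset\partial\mathbb D\setminus\{1\}$, with density of zeros $d\nu=d\theta/2\pi$. That is: the normalized zero counting measures $\frac1n\sum_{\tilde\varphi_n(z)=0}\delta_z$ (with multiplicity) converge weakly to the probability measure $\nu=d\theta/2\pi$ on $\partial\mathbb D$; the symmetric derivative $d\nu/d\theta$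 exists on $K$ and is continuous and nonvanishing there; and $$\lim_{n\to\infty}\ \sup\Bigl\{\Bigl|\,n(\theta'-\theta)-\Bigl(\frac{d\nu}{d\theta}(e^{i\theta})\Bigr)^{-1}\Bigr| \Bigm| e^{i\theta},e^{i\theta'}\in K \text{ successive zeros of }\tilde\varphi_n\Bigr\}=0 ,$$ where $e^{i\theta},e^{i\theta'}$ with $\theta<\theta'$ are successive zeros of $\tilde\varphi_n$ if both are zeros and $\tilde\varphi_n(e^{it})\ne0$ for all $t\in(\theta,\theta')$ (and the supremum over the empty set is $0$). -/

import Mathlib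

/-- The reversed polynomial of degree `n`: `p*(z) = zⁿ · conj (p (1 / conj z))`,
that is, `p*(z) = ∑ₖ conj (c_{n-k}) zᵏ` for `p(z) = ∑ₖ cₖ zᵏ` of degree at most `n`. -/
noncomputable def reversedPoly (n : ℕ) (p : Polynomial ℂ) : Polynomial ℂ :=
  (p.map (starRingEnd ℂ)).reflect n

/-- The orthonormal polynomials `φₙ` on the unit circle with Verblunsky coefficients `α`,
given by the Szegő recursion
`φ₀ = 1`, `φₙ₊₁(z) = (1 - |αₙ|²)^(-1/2) (z φₙ(z) - conj(αₙ) φₙ*(z))`. -/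
noncomputable def opuc (α : ℕ → ℂ) : ℕ → Polynomial ℂ
  | 0 => 1
  | n + 1 =>
      Polynomial.C (((Real.sqrt (1 - ‖α n‖ ^ 2))⁻¹ : ℝ) : ℂ) *
        (Polynomial.X * opuc α n
          - Polynomial.C (starRingEnd ℂ (α n)) * reversedPoly n (opuc α n))

/-- The paraorthogonal polynomials: for `n ≥ 1` and `|βₙ| = 1`,
`z φₙ₋₁(z) - conj(βₙ) φₙ₋₁*(z)`, of degree `n`. The value at `n = 0` is a convention. -/
noncomputable def popuc (α : ℕ → ℂ) (β : ℕ → ℂ) : ℕ → Polynomial ℂ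
  | 0 => 1
  | n + 1 =>
      Polynomial.X * opuc α n
        - Polynomial.C (starRingEnd ℂ (β (n + 1))) * reversedPoly n (opuc α n)

/-- The normalized arc length `dθ / 2π` on the unit circle, as a measure on `ℂ`. -/
noncomputable def normalizedArcLength : MeasureTheory.Measure ℂ :=
  ENNReal.ofReal (2 * Real.pi)⁻¹ •
    MeasureTheory.Measure.map (fun θ : ℝ => Complex.exp (θ * Complex.I))
      (MeasureTheory.volume.restrict (Set.Ioc (-Real.pi) Real.pi))

/-- `ν` is the density of zeros of the sequence `p n` of polynomials of degree `n`: the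
normalized zero counting measures `(1/n) ∑ δ_z` (zeros counted with multiplicity) converge
weakly to the probability measure `ν`. -/
def IsDensityOfZeros (p : ℕ → Polynomial ℂ) (ν : MeasureTheory.Measure ℂ) : Prop :=
  MeasureTheory.IsProbabilityMeasure ν ∧
    ∀ f : BoundedContinuousFunction ℂ ℝ,
      Filter.Tendsto (fun n : ℕ => ((p n).roots.map (fun z => f z)).sum / (n : ℝ))
        Filter.atTop (nhds (∫ z, f z ∂ν))

/-- The symmetric derivative `dν/dθ` of `ν` along the unit circle exists at the point `z` of the
circle and equals `w`: the `ν`-mass of the arc of half-length `δ` about `z`, divided by `2δ`,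
tends to `w` as `δ ↓ 0`. -/
def HasArcDensityAt (ν : MeasureTheory.Measure ℂ) (z : ℂ) (w : ℝ) : Prop :=
  Filter.Tendsto
    (fun δ : ℝ =>
      ν.real ((fun t : ℝ => z * Complex.exp (t * Complex.I)) '' Set.Ioo (-δ) δ) / (2 * δ))
    (nhdsWithin 0 (Set.Ioi 0)) (nhds w)

/-- The angles `θ < θ'` are successive zeros of `q` on the unit circle: `e^{iθ}` and `e^{iθ'}`
are zeros, and the open arc run through between them, counterclockwise, holds no zero. -/
def AreSuccessiveZeros (q : Polynomial ℂ) (θ θ' : ℝ) : Prop :=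
  θ < θ' ∧ q.IsRoot (Complex.exp (θ * Complex.I)) ∧ q.IsRoot (Complex.exp (θ' * Complex.I)) ∧
    ∀ t ∈ Set.Ioo θ θ', ¬ q.IsRoot (Complex.exp (t * Complex.I))

/-- Uniform clock behavior, on a subset `K` of the unit circle, of the zeros of the polynomials
`p n` with density of zeros `ν`: the derivative `dν/dθ` is continuous and nonvanishing on `K`,
and `sup |n (θ' - θ) - (dν/dθ)⁻¹| → 0` as `n → ∞`, the supremum being over all pairs of
successive zeros of `p n` that lie in `K`. -/
def UniformClockBehavior (p : ℕ → Polynomial ℂ) (ν : MeasureTheory.Measure ℂ) (K : Set ℂ) :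
    Prop :=
  IsDensityOfZeros p ν ∧
    ∃ w : ℂ → ℝ,
      (∀ z ∈ K, HasArcDensityAt ν z (w z)) ∧ ContinuousOn w K ∧ (∀ z ∈ K, w z ≠ 0) ∧
      ∀ ε > 0, ∃ N : ℕ, ∀ n ≥ N, ∀ θ θ' : ℝ,
        Complex.exp (θ * Complex.I) ∈ K → Complex.exp (θ' * Complex.I) ∈ K →
        AreSuccessiveZeros (p n) θ θ' →
        |(n : ℝ) * (θ' - θ) - (w (Complex.exp (θ * Complex.I)))⁻¹| ≤ ε

/-! On the circle `z φₙ = φₙ* exp (i Θₙ)`, so the zeros of the paraorthogonal polynomial of degree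
`n + 1` are the points where `exp (i Θₙ) = conj βₙ₊₁`. The phase `Θₙ` is strictly increasing, hence
it gains exactly `2π` between successive zeros, and clock behavior amounts to `Θₙ' = (n + 1)(1 +
o(1))` uniformly away from `z = 1`.

With `Rₙ = |φₙ|²` one has `Θₙ' = (R₀ + ... + Rₙ) / Rₙ` (`hasDerivAt_pruferPhase`), so it suffices
that `Rₘ / Rₙ → 1` uniformly (`exists_abs_pruferAmp_sub_le`). The form `Rₙ (1 + Re (2 αₙ exp (i Θₙ)
/ (z - 1)))` is conserved when the coefficient is frozen (`pruferAmp_invariant`). When it varies,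
the logarithm of the form moves by `O(|αₙ₊₁ - αₙ| / |z - 1|)`, which is summable, and `αₙ → 0` makes
the form asymptotic to `Rₙ`.

For the density of zeros, monotonicity and the exact total increase `2π (n + 1)` control `Θₙ` near
`z = 1` as well. The `j`-th zero then has angle `2πj / (n + 1) + o(1)`, and averages over the zeros
become Riemann sums. -/

open Complex in
/-- The Prüfer phases `Θₙ(x)`, for which `z φₙ(z) = φₙ*(z) exp (i Θₙ(x))` at `z = exp (i x)`. -/
noncomputable def pruferPhase (α : ℕ → ℂ) : ℕ → ℝ → ℝ
  | 0, x => x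
  | n + 1, x =>
      x + pruferPhase α n x - 2 * arg (1 - α n * exp (pruferPhase α n x * I))

open Complex in
/-- The squared Prüfer amplitudes, equal to `|φₙ(exp (i x))|²`. -/
noncomputable def pruferAmp (α : ℕ → ℂ) : ℕ → ℝ → ℝ
  | 0, _ => 1
  | n + 1, x =>
      pruferAmp α n x * (‖1 - α n * exp (pruferPhase α n x * I)‖ ^ 2 / (1 - ‖α n‖ ^ 2))

/-! ### Prüfer variables: recursion, derivative, conserved form -/

section Prufer

open Complex ComplexConjugate

theorem exp_neg_two_arg_mul_I {u : ℂ} (hu : u ≠ 0) :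
    exp (((-2 * arg u : ℝ) : ℂ) * I) = conj u / u := by
  have h : (‖u‖ : ℂ) ≠ 0 := by simpa using hu
  have h1 : u = ‖u‖ * exp (arg u * I) := (norm_mul_exp_arg_mul_I u).symm
  have h2 : conj u = ‖u‖ * exp (-(arg u * I)) := by
    conv_lhs => rw [h1]
    rw [map_mul, conj_ofReal, ← exp_conj, map_mul, conj_ofReal, conj_I, mul_neg]
  rw [eq_div_iff hu, h2]
  calc _ = exp (((-2 * arg u : ℝ) : ℂ) * I) * (‖u‖ * exp (arg u * I)) := by rw [← h1]
    _ = ‖u‖ * (exp (((-2 * arg u : ℝ) : ℂ) * I) * exp (arg u * I)) := by ring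
    _ = _ := by
      rw [← exp_add]; congr 2; push_cast; ring

/-- This keeps `1 - a exp (i t)` in the slit plane, so the principal argument is smooth and the
phases have no jumps. -/
theorem one_sub_mul_unit_re_pos {a : ℂ} (ha : ‖a‖ < 1) (t : ℝ) :
    0 < (1 - a * exp (t * I)).re := by
  have h : ‖a * exp (t * I)‖ < 1 := by rw [norm_mul, norm_exp_ofReal_mul_I, mul_one]; exact ha
  have := (re_le_norm (a * exp (t * I)))
  simp only [sub_re, one_re]; linarith

theorem one_sub_mul_unit_ne_zero {a : ℂ} (ha : ‖a‖ < 1) (t : ℝ) :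
    1 - a * exp (t * I) ≠ 0 := fun h => by
  have := one_sub_mul_unit_re_pos ha t
  rw [h] at this; simp at this

theorem one_sub_sq_norm_pos {a : ℂ} (ha : ‖a‖ < 1) : 0 < 1 - ‖a‖ ^ 2 := by
  nlinarith [norm_nonneg a]

variable {α : ℕ → ℂ}

theorem pruferAmp_pos (hα : ∀ n, ‖α n‖ < 1) (n : ℕ) (x : ℝ) : 0 < pruferAmp α n x := by
  induction n with
  | zero => simp [pruferAmp]
  | succ n ih =>
    have := norm_pos_iff.2 (one_sub_mul_unit_ne_zero (hα n) (pruferPhase α n x))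
    have := one_sub_sq_norm_pos (hα n)
    rw [pruferAmp]; positivity

theorem exp_pruferPhase_succ (hα : ∀ n, ‖α n‖ < 1) (n : ℕ) (x : ℝ) :
    exp (pruferPhase α (n + 1) x * I) = exp (x * I) * exp (pruferPhase α n x * I) *
      (conj (1 - α n * exp (pruferPhase α n x * I)) / (1 - α n * exp (pruferPhase α n x * I))) := by
  rw [← exp_neg_two_arg_mul_I (one_sub_mul_unit_ne_zero (hα n) _), ← exp_add, ← exp_add,
    pruferPhase]
  congr 1; push_cast; ring

/-- The `arg` correction depends only on `exp (i Θₙ)`, so it is periodic; each step of the recursion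
adds one turn, from the summand `x`. -/
theorem pruferPhase_add_two_pi (n : ℕ) (x : ℝ) :
    pruferPhase α n (x + 2 * Real.pi) = pruferPhase α n x + (n + 1) * (2 * Real.pi) := by
  induction n with
  | zero => simp [pruferPhase]
  | succ n ih =>
    have : exp (((pruferPhase α n x + (n + 1) * (2 * Real.pi) : ℝ) : ℂ) * I) =
        exp (pruferPhase α n x * I) := by
      rw [exp_eq_exp_iff_exists_int]
      exact ⟨n + 1, by push_cast; ring⟩
    rw [pruferPhase, ih, this, pruferPhase]; push_cast; ring

theorem conj_exp_ofReal_mul_I (t : ℝ) : conj (exp (t * I)) = (exp (t * I))⁻¹ := by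
  rw [← exp_conj, ← exp_neg, map_mul, conj_ofReal, conj_I, mul_neg]

/-- The new phase is that of the disk automorphism `B ↦ (B - conj a) / (1 - a B)` on the circle,
whose angular derivative is a Poisson kernel. -/
theorem hasDerivAt_arg_one_sub {a : ℂ} (ha : ‖a‖ < 1) {f : ℝ → ℝ} {f' x : ℝ}
    (hf : HasDerivAt f f' x) :
    HasDerivAt (fun t => f t - 2 * arg (1 - a * exp (f t * I)))
      (f' * ((1 - ‖a‖ ^ 2) / ‖1 - a * exp (f x * I)‖ ^ 2)) x := by
  set u := 1 - a * exp (f x * I) with hu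
  have hne : u ≠ 0 := one_sub_mul_unit_ne_zero ha _
  have h1 : HasDerivAt (fun t => 1 - a * exp (f t * I))
      (-(a * (exp (f x * I) * (f' * I)))) x :=
    (((hf.ofReal_comp.mul_const I).cexp).const_mul a).const_sub 1
  have h2 := h1.clog_real (Or.inl (one_sub_mul_unit_re_pos ha _))
  have h3 := imCLM.hasFDerivAt.comp_hasDerivAt x h2
  have h4 : HasDerivAt (fun t => f t - 2 * arg (1 - a * exp (f t * I))) _ x :=
    (hf.sub (h3.const_mul 2)).congr_of_eventuallyEq
      (Filter.Eventually.of_forall fun t => by simp [log_im])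
  refine h4.congr_deriv ?_
  have hn : normSq u ≠ 0 := by simpa using hne
  have ha2 : normSq (a * exp (f x * I)) = ‖a‖ ^ 2 := by
    rw [normSq_eq_norm_sq, norm_mul, norm_exp_ofReal_mul_I, mul_one]
  have key : (-(a * (exp (f x * I) * (f' * I)))) / u = f' * (I * (-(a * exp (f x * I)) / u)) := by
    ring
  rw [← hu, key, ← normSq_eq_norm_sq u, ← ha2, show a * exp (f x * I) = 1 - u by rw [hu]; ring]
  simp only [imCLM_apply, im_ofReal_mul, I_mul_im, div_re, neg_re, neg_im, sub_re, sub_im, one_re,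
    one_im]
  field_simp
  simp only [normSq_apply, sub_re, sub_im, one_re, one_im]
  ring

/-- The Poisson factor is `Rₙ / Rₙ₊₁`, so `Rₙ₊₁ Θₙ₊₁' = Rₙ₊₁ + Rₙ Θₙ'`, which sums up. This is the
Christoffel–Darboux formula on the diagonal. -/
theorem hasDerivAt_pruferPhase (hα : ∀ n, ‖α n‖ < 1) (n : ℕ) (x : ℝ) :
    HasDerivAt (pruferPhase α n)
      ((∑ j ∈ Finset.range (n + 1), pruferAmp α j x) / pruferAmp α n x) x := by
  induction n with
  | zero =>
    simpa [pruferAmp, pruferPhase] using! hasDerivAt_id' x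
  | succ n ih =>
    have h := (hasDerivAt_id x).add (hasDerivAt_arg_one_sub (hα n) ih)
    have e : pruferPhase α (n + 1) = fun t => id t + (pruferPhase α n t -
        2 * arg (1 - α n * exp (pruferPhase α n t * I))) := by
      ext t; rw [pruferPhase, id]; ring
    rw [e]
    refine h.congr_deriv ?_
    have hp := (pruferAmp_pos hα n x).ne'
    have h1 := norm_ne_zero_iff.2 (one_sub_mul_unit_ne_zero (hα n) (pruferPhase α n x))
    have h2 := (one_sub_sq_norm_pos (hα n)).ne'
    rw [Finset.sum_range_succ _ (n + 1), pruferAmp]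
    field_simp
    ring

theorem continuous_pruferPhase (hα : ∀ n, ‖α n‖ < 1) (n : ℕ) : Continuous (pruferPhase α n) :=
  continuous_iff_continuousAt.2 fun x => (hasDerivAt_pruferPhase hα n x).continuousAt

theorem strictMono_pruferPhase (hα : ∀ n, ‖α n‖ < 1) (n : ℕ) : StrictMono (pruferPhase α n) :=
  strictMono_of_hasDerivAt_pos (hasDerivAt_pruferPhase hα n) fun x =>
    div_pos (Finset.sum_pos (fun j _ => pruferAmp_pos hα j x) ⟨0, by simp⟩) (pruferAmp_pos hα n x)

/-- For constant Verblunsky coefficients, `|φₙ|² + 2 Re (α z φₙ conj (φₙ*) / (z - 1))` does not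
depend on `n`. -/
theorem pruferAmp_invariant (hα : ∀ n, ‖α n‖ < 1) (n : ℕ) {x : ℝ} (hx : exp (x * I) ≠ 1) :
    pruferAmp α (n + 1) x * (1 + (2 / (exp (x * I) - 1) * (α n *
        exp (pruferPhase α (n + 1) x * I))).re) =
      pruferAmp α n x * (1 + (2 / (exp (x * I) - 1) * (α n *
        exp (pruferPhase α n x * I))).re) := by
  have hu := one_sub_mul_unit_ne_zero (hα n) (pruferPhase α n x)
  have hρ : (1 - α n * conj (α n) : ℂ) ≠ 0 := by
    rw [mul_conj, normSq_eq_norm_sq]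
    exact_mod_cast (one_sub_sq_norm_pos (hα n)).ne'
  rw [exp_pruferPhase_succ hα, pruferAmp, mul_assoc]
  congr 1
  apply ofReal_injective
  have hz : conj (exp (x * I)) = (exp (x * I))⁻¹ := conj_exp_ofReal_mul_I x
  have hB : conj (exp (pruferPhase α n x * I)) = (exp (pruferPhase α n x * I))⁻¹ :=
    conj_exp_ofReal_mul_I _
  have hz0 := exp_ne_zero (x * I)
  have hB0 := exp_ne_zero (pruferPhase α n x * I)
  have hcu : conj (1 - α n * exp (pruferPhase α n x * I)) ≠ 0 :=
    (map_ne_zero _).2 hu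
  push_cast
  rw [re_eq_add_conj, re_eq_add_conj, ← mul_conj', ← mul_conj']
  simp only [map_sub, map_mul, map_div₀, map_one, map_ofNat, conj_conj, map_inv₀, inv_inv, hz, hB] at hcu ⊢
  -- Conjugation on the circle is inversion, so what remains is a rational identity in four
  -- independent variables.
  generalize exp (x * I) = z at *
  generalize exp (pruferPhase α n x * I) = B at *
  generalize conj (α n) = b at *
  generalize α n = a at *
  have hz1 : z - 1 ≠ 0 := sub_ne_zero.2 hx
  have hz2 : 1 - z ≠ 0 := sub_ne_zero.2 (Ne.symm hx)
  have e1 : z⁻¹ - 1 = (1 - z) / z := by field_simp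
  have e2 : 1 - b * B⁻¹ = (B - b) / B := by field_simp
  have hBb : B - b ≠ 0 := fun h => hcu (by rw [e2, h, zero_div])
  rw [e1, e2, show 1 - z = -(z - 1) by ring]
  field_simp
  ring

end Prufer

/-! ### Ratio asymptotics of the amplitudes and the phase derivative -/

section Asymptotics

open Complex ComplexConjugate Filter

theorem abs_log_sub_log_le {u v δ : ℝ} (hu : 0 < u) (h : |v - u| ≤ δ * u) (hδ : δ ≤ 1 / 2) :
    |Real.log v - Real.log u| ≤ 2 * δ := by
  obtain ⟨h1, h2⟩ := abs_le.1 h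
  have hv : 0 < v := by nlinarith
  have ht : 0 < v / u := div_pos hv hu
  have hlo : 1 - δ ≤ v / u := by rw [le_div_iff₀ hu]; linarith
  have hhi : v / u ≤ 1 + δ := by rw [div_le_iff₀ hu]; linarith
  rw [← Real.log_div hv.ne' hu.ne']
  have hδ0 : 0 ≤ δ := by linarith
  have h3 := Real.log_le_sub_one_of_pos ht
  have h4 := Real.one_sub_inv_le_log_of_pos ht
  have h5 : (v / u)⁻¹ ≤ 1 + 2 * δ := by
    rw [inv_le_comm₀ ht (by linarith)]
    refine le_trans ?_ hlo
    rw [inv_le_iff_one_le_mul₀ (by linarith)]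
    nlinarith
  exact abs_le.2 ⟨by linarith, by linarith⟩

theorem abs_sub_le_of_abs_log_sub_log_le {u v δ : ℝ} (hu : 0 < u) (hv : 0 < v)
    (h : |Real.log v - Real.log u| ≤ δ) (hδ : δ ≤ 1) : |v - u| ≤ 2 * δ * u := by
  have h1 := Real.abs_exp_sub_one_le (h.trans hδ)
  rw [Real.exp_sub, Real.exp_log hv, Real.exp_log hu] at h1
  have : v - u = (v / u - 1) * u := by field_simp
  rw [this, abs_mul, abs_of_pos hu]
  gcongr
  linarith

theorem exists_sum_Ico_le {f : ℕ → ℝ} (hf : Summable f) {ε : ℝ} (hε : 0 < ε) :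
    ∃ N, ∀ m n, N ≤ m → m ≤ n → ∑ k ∈ Finset.Ico m n, f k ≤ ε := by
  obtain ⟨N, hN⟩ := Metric.cauchySeq_iff.1 hf.hasSum.tendsto_sum_nat.cauchySeq ε hε
  refine ⟨N, fun m n hm hmn => ?_⟩
  rw [Finset.sum_Ico_eq_sub _ hmn]
  exact (le_abs_self _).trans (hN n (hm.trans hmn) m hm).le

variable {α : ℕ → ℂ}

/-- Away from `z = 1` the ratios of the squared amplitudes tend to `1` uniformly. -/
theorem exists_abs_pruferAmp_sub_le (hα : ∀ n, ‖α n‖ < 1)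
    (hbv : Summable (fun n : ℕ => ‖α (n + 1) - α n‖))
    (hlim : Tendsto (fun n : ℕ => ‖α n‖) atTop (nhds 0)) {d ε : ℝ} (hd : 0 < d) (hε : 0 < ε) :
    ∃ N, ∀ m n, N ≤ m → N ≤ n → ∀ x : ℝ, d ≤ ‖exp (x * I) - 1‖ →
      |pruferAmp α m x - pruferAmp α n x| ≤ ε * pruferAmp α n x := by
  set η := min 1 (ε / 2) with hη
  have hη0 : 0 < η := by positivity
  have hη1 : η ≤ 1 := min_le_left _ _
  have hηε : η ≤ ε / 2 := min_le_right _ _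
  -- Error budget for the logarithms: `N₁` makes each of the two passages between `R` and the form
  -- `q` cost `η / 4`, and `N₂` makes the total drift of `log q` cost `η / 2`.
  obtain ⟨N₁, hN₁⟩ := eventually_atTop.1
    (hlim.eventually_le_const (show 0 < d / 2 * (η / 8) by positivity))
  obtain ⟨N₂, hN₂⟩ := exists_sum_Ico_le hbv (show 0 < d / 8 * (η / 2) by positivity)
  have main : ∀ m n, max N₁ N₂ ≤ m → m ≤ n → ∀ x : ℝ, d ≤ ‖exp (x * I) - 1‖ →
      |Real.log (pruferAmp α m x) - Real.log (pruferAmp α n x)| ≤ η := by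
    intro m n hm hmn x hx
    have hx1 : exp (x * I) ≠ 1 := fun h => by rw [h, sub_self, norm_zero] at hx; linarith
    set g := 2 / (exp (x * I) - 1) with hg
    have hgn : ‖g‖ ≤ 2 / d := by
      rw [hg, norm_div]; simp only [Complex.norm_ofNat]; gcongr
    have hre : ∀ (a : ℂ) (t : ℝ), |(g * (a * exp (t * I))).re| ≤ 2 / d * ‖a‖ := fun a t => by
      refine (abs_re_le_norm _).trans ?_
      rw [norm_mul, norm_mul, norm_exp_ofReal_mul_I, mul_one]
      gcongr
    set q : ℕ → ℝ := fun k => pruferAmp α k x * (1 + (g * (α k * exp (pruferPhase α k x * I))).re)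
      with hq
    have hqR : ∀ k, m ≤ k → |q k - pruferAmp α k x| ≤ η / 8 * pruferAmp α k x := by
      intro k hk
      have h1 : q k - pruferAmp α k x =
          (g * (α k * exp (pruferPhase α k x * I))).re * pruferAmp α k x := by simp only [hq]; ring
      rw [h1, abs_mul, abs_of_pos (pruferAmp_pos hα k x)]
      gcongr
      · exact (pruferAmp_pos hα k x).le
      refine (hre _ _).trans ?_
      have := hN₁ k ((le_max_left _ _).trans (hm.trans hk))
      calc 2 / d * ‖α k‖ ≤ 2 / d * (d / 2 * (η / 8)) := by gcongr
        _ = η / 8 := by field_simp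
    have hlogq : ∀ k, m ≤ k → |Real.log (q k) - Real.log (pruferAmp α k x)| ≤ η / 4 := by
      intro k hk
      have := abs_log_sub_log_le (pruferAmp_pos hα k x) (hqR k hk) (by linarith)
      linarith
    have hstep : ∀ k, m ≤ k → dist (Real.log (q k)) (Real.log (q (k + 1))) ≤
        8 / d * ‖α (k + 1) - α k‖ := by
      intro k hk
      have hR := pruferAmp_pos hα (k + 1) x
      have h1 := (abs_le.1 (hqR (k + 1) (by omega))).1
      have hq0 : pruferAmp α (k + 1) x ≤ 2 * q (k + 1) := by nlinarith
      -- By conservation, `q k` may be rewritten at index `k + 1` with `α k` kept; only the change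
      -- of coefficient survives.
      have h2 : q k - q (k + 1) = pruferAmp α (k + 1) x *
          -(g * ((α (k + 1) - α k) * exp (pruferPhase α (k + 1) x * I))).re := by
        simp only [hq]
        rw [hg, ← pruferAmp_invariant hα k hx1, sub_mul, mul_sub, sub_re]
        ring
      have h3 : |q k - q (k + 1)| ≤ 4 / d * ‖α (k + 1) - α k‖ * q (k + 1) := by
        rw [h2, abs_mul, abs_neg, abs_of_pos hR]
        calc _ ≤ (2 * q (k + 1)) * (2 / d * ‖α (k + 1) - α k‖) := by
              gcongr
              · linarith
              · exact hre _ _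
          _ = _ := by ring
      have h4 := hN₂ k (k + 1) ((le_max_right _ _).trans (hm.trans hk)) (by omega)
      rw [Finset.sum_Ico_succ_top le_rfl, Finset.Ico_self, Finset.sum_empty, zero_add] at h4
      have h5 : 4 / d * ‖α (k + 1) - α k‖ ≤ 1 / 2 := by
        calc _ ≤ 4 / d * (d / 8 * (η / 2)) := by gcongr
          _ = η / 4 := by field_simp; norm_num
          _ ≤ 1 / 2 := by linarith
      have h6 := abs_log_sub_log_le (show 0 < q (k + 1) by linarith) h3 h5
      rw [Real.dist_eq]
      calc _ ≤ _ := h6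
        _ = _ := by ring
    have htel := dist_le_Ico_sum_of_dist_le (f := fun k => Real.log (q k)) hmn
      (d := fun k => 8 / d * ‖α (k + 1) - α k‖) fun hk _ => hstep _ hk
    rw [← Finset.mul_sum] at htel
    have h7 : dist (Real.log (q m)) (Real.log (q n)) ≤ η / 2 := by
      calc _ ≤ _ := htel
        _ ≤ 8 / d * (d / 8 * (η / 2)) := by
          gcongr
          exact hN₂ m n ((le_max_right _ _).trans hm) hmn
        _ = η / 2 := by field_simp
    rw [Real.dist_eq] at h7
    have h8 := abs_le.1 (hlogq m le_rfl)
    have h9 := abs_le.1 (hlogq n hmn)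
    have h10 := abs_le.1 h7
    exact abs_le.2 ⟨by linarith, by linarith⟩
  refine ⟨max N₁ N₂, fun m n hm hn x hx => ?_⟩
  have h : |Real.log (pruferAmp α m x) - Real.log (pruferAmp α n x)| ≤ η := by
    rcases le_total m n with hmn | hmn
    · exact main m n hm hmn x hx
    · rw [abs_sub_comm]; exact main n m hn hmn x hx
  refine (abs_sub_le_of_abs_log_sub_log_le (pruferAmp_pos hα n x) (pruferAmp_pos hα m x) h
    hη1).trans ?_
  gcongr
  · exact (pruferAmp_pos hα n x).le
  · linarith

/-- Crude bounds, uniform in `x`, for the finitely many early indices that the ratio asymptotics do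
not reach. -/
theorem exists_pruferAmp_bounds (hα : ∀ n, ‖α n‖ < 1) (n : ℕ) :
    ∃ c C : ℝ, 0 < c ∧ 0 < C ∧ ∀ x, c ≤ pruferAmp α n x ∧ pruferAmp α n x ≤ C := by
  induction n with
  | zero => exact ⟨1, 1, one_pos, one_pos, fun x => by simp [pruferAmp]⟩
  | succ n ih =>
    obtain ⟨c, C, hc, hC, h⟩ := ih
    have h1 := one_sub_sq_norm_pos (hα n)
    have h2 : 0 < 1 - ‖α n‖ := sub_pos.2 (hα n)
    refine ⟨c * ((1 - ‖α n‖) ^ 2 / (1 - ‖α n‖ ^ 2)), C * (2 ^ 2 / (1 - ‖α n‖ ^ 2)),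
      by positivity, by positivity, fun x => ?_⟩
    have hn : ‖α n * exp (pruferPhase α n x * I)‖ = ‖α n‖ := by
      rw [norm_mul, norm_exp_ofReal_mul_I, mul_one]
    have h3 := norm_sub_norm_le (1 : ℂ) (α n * exp (pruferPhase α n x * I))
    have h4 := norm_sub_le (1 : ℂ) (α n * exp (pruferPhase α n x * I))
    rw [hn, norm_one] at h3 h4
    have hR := pruferAmp_pos hα n x
    rw [pruferAmp]
    constructor
    · gcongr
      exact (h x).1
    · gcongr
      · exact (h x).2
      · linarith [hα n]

/-- Away from `z = 1` the derivative of the `n`-th Prüfer phase is `n + 1 + o(n)` uniformly. -/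
theorem exists_abs_deriv_pruferPhase_sub_le (hα : ∀ n, ‖α n‖ < 1)
    (hbv : Summable (fun n : ℕ => ‖α (n + 1) - α n‖))
    (hlim : Tendsto (fun n : ℕ => ‖α n‖) atTop (nhds 0)) {d ε : ℝ} (hd : 0 < d) (hε : 0 < ε) :
    ∃ N, ∀ n, N ≤ n → ∀ x : ℝ, d ≤ ‖exp (x * I) - 1‖ →
      |deriv (pruferPhase α n) x - (n + 1)| ≤ ε * (n + 1) := by
  obtain ⟨N, hN⟩ := exists_abs_pruferAmp_sub_le hα hbv hlim hd (half_pos hε)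
  choose c C hc hC hb using exists_pruferAmp_bounds hα
  -- `M` bounds the early terms relative to `Rₙ`: `R_j ≤ C j` is compared with `Rₙ` through `c N ≤
  -- R_N ≤ (1 + ε / 2) Rₙ`, and the `1` pays for the subtracted `Rₙ`.
  set M := ∑ j ∈ Finset.range N, (C j * ((1 + ε / 2) / c N) + 1) with hM
  obtain ⟨N', hN'⟩ := exists_nat_ge (M / (ε / 2))
  refine ⟨max N N', fun n hn x hx => ?_⟩
  have hNn : N ≤ n := (le_max_left _ _).trans hn
  have hR := pruferAmp_pos hα n x
  rw [(hasDerivAt_pruferPhase hα n x).deriv]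
  have h1 : (∑ j ∈ Finset.range (n + 1), pruferAmp α j x) / pruferAmp α n x - (n + 1) =
      (∑ j ∈ Finset.range (n + 1), (pruferAmp α j x - pruferAmp α n x)) / pruferAmp α n x := by
    rw [Finset.sum_sub_distrib, Finset.sum_const, Finset.card_range, nsmul_eq_mul]
    push_cast; field_simp
  rw [h1, abs_div, abs_of_pos hR, div_le_iff₀ hR]
  refine (Finset.abs_sum_le_sum_abs _ _).trans ?_
  rw [Finset.range_eq_Ico, ← Finset.sum_Ico_consecutive _ (Nat.zero_le N) (show N ≤ n + 1 by omega)]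
  have hcN : c N ≤ (1 + ε / 2) * pruferAmp α n x := by
    have h2 := (abs_le.1 (hN N n le_rfl hNn x hx)).2
    have h3 := (hb N x).1
    linarith
  have h4 : ∑ j ∈ Finset.Ico 0 N, |pruferAmp α j x - pruferAmp α n x| ≤ M * pruferAmp α n x := by
    rw [hM, Finset.sum_mul, ← Finset.range_eq_Ico]
    refine Finset.sum_le_sum fun j _ => ?_
    have h5 := (hb j x).2
    have h6 := pruferAmp_pos hα j x
    have h7 : C j ≤ C j * ((1 + ε / 2) / c N) * pruferAmp α n x := by
      calc C j = C j * (c N / c N) := by rw [div_self (hc N).ne', mul_one]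
        _ ≤ C j * (((1 + ε / 2) * pruferAmp α n x) / c N) := by
          have := hc N
          have := hC j
          gcongr
        _ = _ := by ring
    exact abs_le.2 ⟨by nlinarith, by nlinarith⟩
  have h8 : ∑ j ∈ Finset.Ico N (n + 1), |pruferAmp α j x - pruferAmp α n x| ≤
      (n + 1) * (ε / 2 * pruferAmp α n x) := by
    refine (Finset.sum_le_card_nsmul _ _ (ε / 2 * pruferAmp α n x) fun j hj =>
      hN j n (Finset.mem_Ico.1 hj).1 hNn x hx).trans ?_
    rw [Nat.card_Ico, nsmul_eq_mul]
    gcongr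
    exact_mod_cast Nat.sub_le _ _
  have h9 : M ≤ (n + 1) * (ε / 2) := by
    rw [← div_le_iff₀ (half_pos hε)]
    have : (N' : ℝ) ≤ n := by exact_mod_cast (le_max_right _ _).trans hn
    linarith
  nlinarith

end Asymptotics

/-! ### Zeros as level points of the phase, and their gaps -/

section Zeros

open Complex ComplexConjugate Filter Polynomial

theorem natDegree_reversedPoly_le {n : ℕ} {p : ℂ[X]} (hp : p.natDegree ≤ n) :
    (reversedPoly n p).natDegree ≤ n :=
  natDegree_reflect_le.trans (max_le le_rfl (natDegree_map_le.trans hp))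

theorem eval_reversedPoly {n : ℕ} {p : ℂ[X]} (hp : p.natDegree ≤ n) {z : ℂ} (hz : ‖z‖ = 1) :
    (reversedPoly n p).eval z = z ^ n * conj (p.eval z) := by
  have hz0 : z ≠ 0 := by rintro rfl; simp at hz
  have hc : conj z = z⁻¹ := by
    rw [inv_def, normSq_eq_norm_sq, hz]; simp
  let : Invertible (z⁻¹) := invertibleOfNonzero (inv_ne_zero hz0)
  have h := eval₂_reflect_mul_pow (RingHom.id ℂ) z⁻¹ n (p.map conj) (natDegree_map_le.trans hp)
  rw [invOf_eq_inv, inv_inv, ← eval, ← eval, ← hc, eval_map, eval₂_at_apply, hc, inv_pow] at h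
  rw [reversedPoly, ← h]
  field_simp

variable {α : ℕ → ℂ}

theorem natDegree_X_mul_sub_C_mul_le {n : ℕ} {p q : ℂ[X]} (c : ℂ) (hp : p.natDegree ≤ n)
    (hq : q.natDegree ≤ n) : (X * p - C c * q).natDegree ≤ n + 1 := by
  refine (natDegree_sub_le _ _).trans (max_le ?_ ?_)
  · refine natDegree_mul_le.trans ?_
    rw [natDegree_X]; omega
  · exact (natDegree_C_mul_le _ _).trans (hq.trans n.le_succ)

theorem natDegree_opuc_le (n : ℕ) : (opuc α n).natDegree ≤ n := by
  induction n with
  | zero => simp [opuc]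
  | succ n ih =>
    rw [opuc]
    exact (natDegree_C_mul_le _ _).trans
      (natDegree_X_mul_sub_C_mul_le _ ih (natDegree_reversedPoly_le ih))

theorem natDegree_popuc_le (β : ℕ → ℂ) (n : ℕ) : (popuc α β (n + 1)).natDegree ≤ n + 1 :=
  natDegree_X_mul_sub_C_mul_le _ (natDegree_opuc_le n)
    (natDegree_reversedPoly_le (natDegree_opuc_le n))

/-- With `w = φₙ*` and `B = exp (i Θₙ)`, the recursion gives `φₙ₊₁ = r w (B - conj αₙ)` and `φₙ₊₁* =
r w (1 - αₙ B)`, where `r > 0`. Nonvanishing and the phase relation therefore propagate together. -/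
theorem eval_opuc_eq_exp_pruferPhase (hα : ∀ n, ‖α n‖ < 1) (n : ℕ) (x : ℝ) :
    (reversedPoly n (opuc α n)).eval (exp (x * I)) ≠ 0 ∧
      exp (x * I) * (opuc α n).eval (exp (x * I)) =
        (reversedPoly n (opuc α n)).eval (exp (x * I)) * exp (pruferPhase α n x * I) := by
  induction n with
  | zero => simp [opuc, reversedPoly, pruferPhase]
  | succ n ih =>
    obtain ⟨hw, h⟩ := ih
    have hz1 : ‖exp (x * I)‖ = 1 := norm_exp_ofReal_mul_I x
    have hzc := conj_exp_ofReal_mul_I x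
    have hBc := conj_exp_ofReal_mul_I (pruferPhase α n x)
    have hz0 := exp_ne_zero (x * I)
    have hB0 := exp_ne_zero (pruferPhase α n x * I)
    have hu := one_sub_mul_unit_ne_zero (hα n) (pruferPhase α n x)
    have hr : (((√(1 - ‖α n‖ ^ 2))⁻¹ : ℝ) : ℂ) ≠ 0 := by
      exact_mod_cast (inv_pos.2 (Real.sqrt_pos.2 (one_sub_sq_norm_pos (hα n)))).ne'
    have hw' := eval_reversedPoly (natDegree_opuc_le (α := α) n) hz1
    rw [eval_reversedPoly (natDegree_opuc_le (n + 1)) hz1, exp_pruferPhase_succ hα]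
    have hφ : (opuc α (n + 1)).eval (exp (x * I)) = (((√(1 - ‖α n‖ ^ 2))⁻¹ : ℝ) : ℂ) *
        (reversedPoly n (opuc α n)).eval (exp (x * I)) *
          (exp (pruferPhase α n x * I) - conj (α n)) := by
      rw [opuc]
      simp only [eval_mul, eval_sub, eval_C, eval_X]
      rw [h]; ring
    have hcw : exp (x * I) ^ (n + 1) * conj ((reversedPoly n (opuc α n)).eval (exp (x * I))) =
        (reversedPoly n (opuc α n)).eval (exp (x * I)) * exp (pruferPhase α n x * I) := by
      rw [← h]
      conv_lhs => rw [hw']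
      rw [map_mul, conj_conj, map_pow, hzc, inv_pow, pow_succ]
      field_simp
    have hφs : exp (x * I) ^ (n + 1) * conj ((opuc α (n + 1)).eval (exp (x * I))) =
        (((√(1 - ‖α n‖ ^ 2))⁻¹ : ℝ) : ℂ) * (reversedPoly n (opuc α n)).eval (exp (x * I)) *
          (1 - α n * exp (pruferPhase α n x * I)) := by
      rw [hφ]
      simp only [map_mul, map_sub, conj_ofReal, conj_conj, hBc]
      rw [show ∀ a b c d : ℂ, a * (b * c * d) = b * (a * c) * d by intros; ring, hcw]
      field_simp
    rw [hφs]
    refine ⟨mul_ne_zero (mul_ne_zero hr hw) hu, ?_⟩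
    rw [hφ, map_sub, map_one, map_mul, hBc]
    generalize exp (pruferPhase α n x * I) = B at *
    have hu' : 1 - B * α n ≠ 0 := by rwa [mul_comm]
    field_simp

theorem isRoot_popuc_iff (hα : ∀ n, ‖α n‖ < 1) (β : ℕ → ℂ) (n : ℕ) (x : ℝ) :
    (popuc α β (n + 1)).IsRoot (exp (x * I)) ↔
      exp (pruferPhase α n x * I) = conj (β (n + 1)) := by
  obtain ⟨hw, h⟩ := eval_opuc_eq_exp_pruferPhase hα n x
  rw [IsRoot, popuc]
  simp only [eval_mul, eval_sub, eval_C, eval_X]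
  rw [h, mul_comm (conj _), ← mul_sub, mul_eq_zero, or_iff_right hw, sub_eq_zero]

/-- The increment is a positive multiple of `2π`; were it at least `4π`, the intermediate value
theorem would produce a zero strictly between. -/
theorem pruferPhase_sub_of_areSuccessiveZeros (hα : ∀ n, ‖α n‖ < 1) {β : ℕ → ℂ} {n : ℕ}
    {θ θ' : ℝ} (h : AreSuccessiveZeros (popuc α β (n + 1)) θ θ') :
    pruferPhase α n θ' - pruferPhase α n θ = 2 * Real.pi := by
  obtain ⟨hlt, h1, h2, h3⟩ := h
  rw [isRoot_popuc_iff hα] at h1 h2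
  obtain ⟨k, hk⟩ := exp_eq_exp_iff_exists_int.1 (h2.trans h1.symm)
  have hk' : pruferPhase α n θ' = pruferPhase α n θ + k * (2 * Real.pi) := by
    have h4 : ((pruferPhase α n θ' : ℝ) : ℂ) * I =
        ((pruferPhase α n θ + k * (2 * Real.pi) : ℝ) : ℂ) * I := by
      rw [hk]; push_cast; ring
    exact_mod_cast mul_right_cancel₀ I_ne_zero h4
  have hmono := strictMono_pruferPhase hα n hlt
  have hpi := Real.pi_pos
  have hk0 : 0 < k := by
    by_contra hneg
    have : (k : ℝ) ≤ 0 := by exact_mod_cast not_lt.1 hneg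
    nlinarith
  rcases (show k = 1 ∨ 2 ≤ k by omega) with rfl | hk2
  · rw [hk']; push_cast; ring
  · have hk2' : (2 : ℝ) ≤ k := by exact_mod_cast hk2
    obtain ⟨t, ht, ht'⟩ := intermediate_value_Ioo hlt.le (continuous_pruferPhase hα n).continuousOn
      (show pruferPhase α n θ + 2 * Real.pi ∈ Set.Ioo _ _ from ⟨by linarith, by nlinarith⟩)
    refine absurd ?_ (h3 t ht)
    rw [isRoot_popuc_iff hα, ht', ← h1, exp_eq_exp_iff_exists_int]
    exact ⟨1, by push_cast; ring⟩

theorem norm_exp_mul_I_sub_le (s t : ℝ) : ‖exp (s * I) - exp (t * I)‖ ≤ |s - t| := by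
  have : exp (s * I) - exp (t * I) = exp (t * I) * (exp (I * (s - t : ℝ)) - 1) := by
    rw [mul_sub, ← exp_add, mul_one]
    congr 2; push_cast; ring
  rw [this, norm_mul, norm_exp_ofReal_mul_I, one_mul]
  exact Real.norm_exp_I_mul_ofReal_sub_one_le

/-- Away from `z = 1` the gaps between successive zeros are `2π / n + o(1 / n)` uniformly. -/
theorem exists_abs_gap_sub_le (hα : ∀ n, ‖α n‖ < 1)
    (hbv : Summable (fun n : ℕ => ‖α (n + 1) - α n‖))
    (hlim : Tendsto (fun n : ℕ => ‖α n‖) atTop (nhds 0)) (β : ℕ → ℂ) {d ε : ℝ} (hd : 0 < d)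
    (hε : 0 < ε) :
    ∃ N, ∀ n, N ≤ n → ∀ θ θ' : ℝ, d ≤ ‖exp (θ * I) - 1‖ →
      AreSuccessiveZeros (popuc α β (n + 1)) θ θ' →
      |((n : ℝ) + 1) * (θ' - θ) - 2 * Real.pi| ≤ ε := by
  have hpi := Real.pi_pos
  -- The bound `1 / 2` gives `Θₙ' ≥ (n + 1) / 2`, hence `(n + 1)(θ' - θ) ≤ 4π`, which explains the
  -- `4π` in the other bound.
  set η := min (1 / 2) (ε / (4 * Real.pi)) with hη
  have hη0 : 0 < η := by positivity
  have hη1 : η ≤ 1 / 2 := min_le_left _ _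
  have hη2 : η * (4 * Real.pi) ≤ ε := (le_div_iff₀ (by positivity)).1 (min_le_right _ _)
  -- Halving `d` leaves room to use the derivative estimate on all of `[θ, θ + d / 2]`.
  obtain ⟨N, hN⟩ := exists_abs_deriv_pruferPhase_sub_le hα hbv hlim (half_pos hd) hη0
  obtain ⟨N', hN'⟩ := exists_nat_ge (4 * Real.pi / (d / 2))
  refine ⟨max N N', fun n hn θ θ' hθ hs => ?_⟩
  have hn' : (N' : ℝ) ≤ n := by exact_mod_cast (le_max_right _ _).trans hn
  have hlt := hs.1
  have h2π := pruferPhase_sub_of_areSuccessiveZeros hα hs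
  have hder : ∀ t, θ ≤ t → t ≤ θ + d / 2 →
      |deriv (pruferPhase α n) t - (n + 1)| ≤ η * (n + 1) := by
    intro t h1 h2
    refine hN n ((le_max_left _ _).trans hn) t ?_
    have h3 := norm_exp_mul_I_sub_le θ t
    have h4 := norm_sub_le_norm_sub_add_norm_sub (exp (θ * I)) (exp (t * I)) 1
    rw [abs_sub_comm, abs_of_nonneg (by linarith)] at h3
    linarith
  have hmvt : ∀ y, θ < y → y ≤ θ + d / 2 → ∃ t, |deriv (pruferPhase α n) t - (n + 1)| ≤ η * (n + 1) ∧
      pruferPhase α n y - pruferPhase α n θ = deriv (pruferPhase α n) t * (y - θ) := by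
    intro y h1 h2
    obtain ⟨t, ht, he⟩ := exists_deriv_eq_slope (pruferPhase α n) h1
      (continuous_pruferPhase hα n).continuousOn
      (fun t _ => (hasDerivAt_pruferPhase hα n t).differentiableAt.differentiableWithinAt)
    refine ⟨t, hder t ht.1.le (ht.2.le.trans h2), ?_⟩
    rw [he, div_mul_cancel₀ _ (by linarith)]
  have hn0 : (0 : ℝ) < n + 1 := by positivity
  -- A longer gap would contain an interval of length `d / 2`, on which the phase already gains more
  -- than `2π`.
  have hle : θ' ≤ θ + d / 2 := by
    by_contra hgt
    obtain ⟨t, h1, h2⟩ := hmvt (θ + d / 2) (by linarith) le_rfl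
    have h3 := strictMono_pruferPhase hα n (not_le.1 hgt)
    have h4 : 4 * Real.pi < (n + 1) * (d / 2) := by
      rw [← div_lt_iff₀ (half_pos hd)]; linarith
    have h5 := (abs_le.1 h1).1
    have h6 : (n + 1) / 2 ≤ deriv (pruferPhase α n) t := by nlinarith
    have h7 : (n + 1) / 2 * (d / 2) ≤ deriv (pruferPhase α n) t * (d / 2) := by gcongr
    rw [add_sub_cancel_left] at h2
    linarith
  obtain ⟨t, h1, h2⟩ := hmvt θ' hlt hle
  have h5 := (abs_le.1 h1).1
  have h6 : ((n : ℝ) + 1) / 2 ≤ deriv (pruferPhase α n) t := by nlinarith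
  have h0 : 0 < θ' - θ := sub_pos.2 hlt
  have h7 : (n + 1) / 2 * (θ' - θ) ≤ deriv (pruferPhase α n) t * (θ' - θ) := by gcongr
  rw [h2] at h2π
  rw [← h2π, ← sub_mul, abs_mul, abs_sub_comm, abs_of_pos h0]
  calc _ ≤ η * (n + 1) * (θ' - θ) := by gcongr
    _ = η * (2 * ((n + 1) / 2 * (θ' - θ))) := by ring
    _ ≤ η * (2 * (2 * Real.pi)) := mul_le_mul_of_nonneg_left (by linarith) hη0.le
    _ ≤ ε := by linarith

end Zeros

/-! ### Arc length and the density of zeros -/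

section Density

open Complex ComplexConjugate Filter MeasureTheory

variable {α : ℕ → ℂ}

theorem exp_add_two_pi_mul_I (x : ℝ) : exp ((x + 2 * Real.pi : ℝ) * I) = exp (x * I) := by
  rw [exp_eq_exp_iff_exists_int]
  exact ⟨1, by push_cast; ring⟩

theorem continuous_exp_ofReal_mul_I : Continuous fun x : ℝ => exp (x * I) := by fun_prop

theorem integral_normalizedArcLength {f : ℂ → ℝ} (hf : Measurable f) :
    ∫ z, f z ∂normalizedArcLength =
      (2 * Real.pi)⁻¹ * ∫ x in (-Real.pi)..Real.pi, f (exp (x * I)) := by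
  rw [normalizedArcLength, integral_smul_measure, integral_map
    continuous_exp_ofReal_mul_I.aemeasurable hf.aestronglyMeasurable,
    intervalIntegral.integral_of_le (by linarith [Real.pi_pos]), ENNReal.toReal_ofReal
    (by positivity), smul_eq_mul]

theorem isProbabilityMeasure_normalizedArcLength :
    IsProbabilityMeasure normalizedArcLength := by
  refine ⟨?_⟩
  have hpi := Real.pi_pos
  rw [normalizedArcLength, Measure.smul_apply, Measure.map_apply
    continuous_exp_ofReal_mul_I.measurable MeasurableSet.univ, Set.preimage_univ,
    Measure.restrict_apply_univ, Real.volume_Ioc, smul_eq_mul,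
    ← ENNReal.ofReal_mul (by positivity)]
  rw [show (2 * Real.pi)⁻¹ * (Real.pi - -Real.pi) = 1 by field_simp; ring, ENNReal.ofReal_one]

theorem exp_mul_I_injOn_Ico (a : ℝ) :
    Set.InjOn (fun x : ℝ => exp (x * I)) (Set.Ico a (a + 2 * Real.pi)) := by
  intro x hx y hy hxy
  obtain ⟨k, hk⟩ := exp_eq_exp_iff_exists_int.1 hxy
  have hk' : x = y + k * (2 * Real.pi) := by
    have h4 : (x : ℂ) * I = ((y + k * (2 * Real.pi) : ℝ) : ℂ) * I := by
      rw [hk]; push_cast; ring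
    exact_mod_cast mul_right_cancel₀ I_ne_zero h4
  have hpi := Real.pi_pos
  have h1 : (k : ℝ) < 1 := by by_contra h; nlinarith [hx.1, hx.2, hy.1, hy.2]
  have h2 : (-1 : ℝ) < k := by by_contra h; nlinarith [hx.1, hx.2, hy.1, hy.2]
  have h3 : k < 1 := by exact_mod_cast h1
  have h4 : -1 < k := by exact_mod_cast h2
  obtain rfl : k = 0 := by omega
  simpa using hk'

/-- For `δ < π` the quotient is exactly constant. Periodicity recenters the window of integration at
`arg z`, so that the arc is not cut at `±π`. -/
theorem hasArcDensityAt_normalizedArcLength {z : ℂ} (hz : ‖z‖ = 1) :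
    HasArcDensityAt normalizedArcLength z (2 * Real.pi)⁻¹ := by
  have hpi := Real.pi_pos
  have := isProbabilityMeasure_normalizedArcLength
  set a := arg z with ha
  have hza : z = exp (a * I) := by
    rw [← norm_mul_exp_arg_mul_I z, hz, ofReal_one, one_mul, ← ha]
  refine tendsto_const_nhds.congr' ?_
  filter_upwards [Ioo_mem_nhdsGT hpi] with δ hδ
  have himage : (fun t : ℝ => z * exp (t * I)) '' Set.Ioo (-δ) δ =
      (fun t : ℝ => exp (t * I)) '' Set.Ioo (a - δ) (a + δ) := by
    have : Set.Ioo (a - δ) (a + δ) = (fun t => a + t) '' Set.Ioo (-δ) δ := by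
      rw [Set.image_const_add_Ioo]; rfl
    rw [this, Set.image_image]
    refine Set.image_congr fun t _ => ?_
    rw [hza, ← exp_add]; congr 1; push_cast; ring
  rw [himage]
  set S := (fun t : ℝ => exp (t * I)) '' Set.Ioo (a - δ) (a + δ) with hS
  have hsub : Set.Ioo (a - δ) (a + δ) ⊆ Set.Ico (a - Real.pi) (a - Real.pi + 2 * Real.pi) :=
    fun x hx => ⟨by linarith [hx.1, hδ.2], by linarith [hx.2, hδ.2]⟩
  have hSm : MeasurableSet S := measurableSet_Ioo.image_of_continuousOn_injOn
    continuous_exp_ofReal_mul_I.continuousOn ((exp_mul_I_injOn_Ico _).mono hsub)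
  rw [← integral_indicator_one hSm,
    integral_normalizedArcLength (f := S.indicator 1) (measurable_one.indicator hSm)]
  have hper : Function.Periodic (fun x : ℝ => S.indicator (1 : ℂ → ℝ) (exp (x * I)))
      (2 * Real.pi) := fun x => by
    simp only [exp_add_two_pi_mul_I]
  have h1 := hper.intervalIntegral_add_eq (-Real.pi) (a - Real.pi)
  rw [show -Real.pi + 2 * Real.pi = Real.pi by ring] at h1
  have h2 : ∫ x in (a - Real.pi)..(a - Real.pi + 2 * Real.pi),
      S.indicator (1 : ℂ → ℝ) (exp (x * I)) = 2 * δ := by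
    rw [intervalIntegral.integral_of_le (by linarith), ← integral_Ico_eq_integral_Ioc]
    have h3 : ∀ x ∈ Set.Ico (a - Real.pi) (a - Real.pi + 2 * Real.pi),
        S.indicator (1 : ℂ → ℝ) (exp (x * I)) =
          (Set.Ioo (a - δ) (a + δ)).indicator (1 : ℝ → ℝ) x := by
      intro x hx
      have : exp (x * I) ∈ S ↔ x ∈ Set.Ioo (a - δ) (a + δ) :=
        (exp_mul_I_injOn_Ico _).mem_image_iff hsub hx
      by_cases h : x ∈ Set.Ioo (a - δ) (a + δ)
      · rw [Set.indicator_of_mem (this.2 h), Set.indicator_of_mem h, Pi.one_apply, Pi.one_apply]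
      · rw [Set.indicator_of_notMem (mt this.1 h), Set.indicator_of_notMem h]
    rw [setIntegral_congr_fun measurableSet_Ico h3, setIntegral_indicator measurableSet_Ioo,
      Set.inter_eq_right.2 hsub]
    simp only [Pi.one_apply, integral_const, smul_eq_mul, mul_one, measureReal_restrict_apply_univ]
    rw [Real.volume_real_Ioo_of_le (by linarith [hδ.1])]
    ring
  rw [h1, h2, mul_div_assoc, div_self (by linarith [hδ.1]), mul_one]

/-- The Prüfer phases satisfy `Θₙ(x) - Θₙ(0) = (n + 1) x + o(n)` uniformly on `[0, 2π]`. -/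
theorem exists_abs_pruferPhase_sub_le (hα : ∀ n, ‖α n‖ < 1)
    (hbv : Summable (fun n : ℕ => ‖α (n + 1) - α n‖))
    (hlim : Tendsto (fun n : ℕ => ‖α n‖) atTop (nhds 0)) {ε : ℝ} (hε : 0 < ε) :
    ∃ N, ∀ n, N ≤ n → ∀ x ∈ Set.Icc 0 (2 * Real.pi),
      |pruferPhase α n x - pruferPhase α n 0 - (n + 1) * x| ≤ ε * (n + 1) := by
  have hpi := Real.pi_gt_three
  have hpi' := Real.pi_lt_d2
  set η := min 1 (ε / 16) with hη
  have hη0 : 0 < η := by positivity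
  have hη1 : η ≤ 1 := min_le_left _ _
  have hηε : 16 * η ≤ ε := by linarith [min_le_right 1 (ε / 16)]
  obtain ⟨d, hd, hdb⟩ := (isCompact_Icc (a := η) (b := 2 * Real.pi - η)).exists_forall_le'
    (f := fun x : ℝ => ‖exp (x * I) - 1‖) (by fun_prop) (a := 0) (fun x hx => by
      rw [norm_pos_iff, sub_ne_zero]
      intro h
      have h0 : x = 0 := exp_mul_I_injOn_Ico 0
        ⟨by linarith [hx.1], by linarith [hx.2]⟩ ⟨le_rfl, by linarith⟩ (by simpa using h)
      linarith [hx.1])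
  obtain ⟨N, hN⟩ := exists_abs_deriv_pruferPhase_sub_le hα hbv hlim hd hη0
  refine ⟨N, fun n hn x hx => ?_⟩
  have hn0 : (0 : ℝ) < n + 1 := by positivity
  have hη' : 0 < η * (n + 1) := by positivity
  have hmono := (strictMono_pruferPhase hα n).monotone
  have htot := pruferPhase_add_two_pi (α := α) n 0
  rw [zero_add] at htot
  have hmid : ∀ y ∈ Set.Icc η (2 * Real.pi - η),
      |pruferPhase α n y - pruferPhase α n η - (n + 1) * (y - η)| ≤ 7 * (η * (n + 1)) := by
    intro y hy
    have hder : ∀ t, HasDerivAt (fun t => pruferPhase α n t - (n + 1) * t)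
        (deriv (pruferPhase α n) t - (n + 1)) t := fun t => by
      simpa using! (hasDerivAt_pruferPhase hα n t).differentiableAt.hasDerivAt.sub
        ((hasDerivAt_id' t).const_mul ((n : ℝ) + 1))
    have h := Convex.norm_image_sub_le_of_norm_hasDerivWithin_le (C := η * (n + 1))
      (fun t _ => (hder t).hasDerivWithinAt)
      (fun t ht => hN n hn t (hdb t ht)) (convex_Icc η (2 * Real.pi - η))
      (Set.left_mem_Icc.2 (by linarith)) hy
    rw [Real.norm_eq_abs, Real.norm_eq_abs, abs_of_nonneg (by linarith [hy.1] : 0 ≤ y - η)] at h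
    calc _ = |pruferPhase α n y - (n + 1) * y - (pruferPhase α n η - (n + 1) * η)| := by
          congr 1; ring
      _ ≤ _ := h
      _ ≤ η * (n + 1) * 7 := by gcongr; linarith [hy.2]
      _ = _ := by ring
  have hend := abs_le.1 (hmid (2 * Real.pi - η) ⟨by linarith, le_rfl⟩)
  have h1 := hmono (show 2 * Real.pi - η ≤ 2 * Real.pi by linarith)
  have h2 := hmono hη0.le
  -- No derivative bound is available near `0` and `2π`. The exact total increase minus the middle
  -- increase leaves at most `(2 + 7) η (n + 1)` for both ends together; adding the middle error `7`
  -- gives the `16`.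
  have hηn : pruferPhase α n η - pruferPhase α n 0 ≤ 9 * (η * (n + 1)) := by nlinarith
  have hεn : 16 * (η * (n + 1)) ≤ ε * (n + 1) := by nlinarith
  refine le_trans ?_ hεn
  rcases le_total x η with hxη | hxη
  · have h3 := hmono hx.1
    have h4 := hmono hxη
    have h5 : (n + 1) * x ≤ (n + 1) * η := by gcongr
    have h6 : 0 ≤ (n + 1) * x := mul_nonneg hn0.le hx.1
    exact abs_le.2 ⟨by linarith, by linarith⟩
  · rcases le_total x (2 * Real.pi - η) with hxη' | hxη'
    · have h3 := abs_le.1 (hmid x ⟨hxη, hxη'⟩)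
      exact abs_le.2 ⟨by nlinarith, by nlinarith⟩
    · have h3 := hmono hxη'
      have h4 := hmono hx.2
      have h5 : (n + 1) * (2 * Real.pi - η) ≤ (n + 1) * x := by gcongr
      have h6 : (n + 1) * x ≤ (n + 1) * (2 * Real.pi) := by gcongr; exact hx.2
      exact abs_le.2 ⟨by nlinarith, by nlinarith⟩

/-- The zeros of the paraorthogonal polynomial of degree `n + 1` are simple and lie on the unit
circle, at angles where the Prüfer phase increases by `2π` from one zero to the next. -/
theorem exists_roots_popuc_eq (hα : ∀ n, ‖α n‖ < 1) {β : ℕ → ℂ} (hβ : ∀ n, ‖β n‖ = 1) (n : ℕ) :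
    ∃ θ : ℕ → ℝ, (∀ j < n + 1, θ j ∈ Set.Icc 0 (2 * Real.pi) ∧
      |pruferPhase α n (θ j) - pruferPhase α n 0 - 2 * Real.pi * j| ≤ 2 * Real.pi) ∧
      (popuc α β (n + 1)).roots =
        (Multiset.range (n + 1)).map fun j => exp (θ j * I) := by
  have hpi := Real.pi_pos
  set Θ := pruferPhase α n with hΘ
  -- With `c` in `[Θ 0, Θ 0 + 2π)`, the levels `c + 2πj`, `j = 0, ..., n`, all lie in the range of
  -- `Θ` on `[0, 2π)`.
  set c := toIcoMod Real.two_pi_pos (Θ 0) (arg (conj (β (n + 1)))) with hc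
  have hcm := toIcoMod_mem_Ico Real.two_pi_pos (Θ 0) (arg (conj (β (n + 1))))
  rw [← hc] at hcm
  have hexp : ∀ k : ℤ, exp ((c + 2 * Real.pi * k : ℝ) * I) = conj (β (n + 1)) := by
    intro k
    have h1 : exp (arg (conj (β (n + 1))) * I) = conj (β (n + 1)) := by
      conv_rhs => rw [← norm_mul_exp_arg_mul_I (conj (β (n + 1))), norm_conj, hβ, ofReal_one,
        one_mul]
    rw [← h1, exp_eq_exp_iff_exists_int]
    refine ⟨k - toIcoDiv Real.two_pi_pos (Θ 0) (arg (conj (β (n + 1)))), ?_⟩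
    rw [hc, toIcoMod, zsmul_eq_mul]; push_cast; ring
  have htot := pruferPhase_add_two_pi (α := α) n 0
  rw [zero_add, ← hΘ] at htot
  have hex : ∀ j : ℕ, ∃ t, j < n + 1 → t ∈ Set.Ico 0 (2 * Real.pi) ∧ Θ t = c + 2 * Real.pi * j := by
    intro j
    by_cases hj : j < n + 1
    · have hj' : (j : ℝ) ≤ n := by exact_mod_cast Nat.lt_succ_iff.1 hj
      have hj2 : 2 * Real.pi * j ≤ 2 * Real.pi * n := by gcongr
      have hj0 : 0 ≤ 2 * Real.pi * j := by positivity
      obtain ⟨t, ht, he⟩ := intermediate_value_Ico Real.two_pi_pos.le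
        (continuous_pruferPhase hα n).continuousOn
        (show c + 2 * Real.pi * j ∈ Set.Ico _ _ from
          ⟨by linarith [hcm.1], by rw [← hΘ, htot]; nlinarith [hcm.2]⟩)
      exact ⟨t, fun _ => ⟨ht, he⟩⟩
    · exact ⟨0, fun h => absurd h hj⟩
  choose θ hθ using hex
  have hroot : ∀ j < n + 1, (popuc α β (n + 1)).IsRoot (exp (θ j * I)) := fun j hj => by
    rw [isRoot_popuc_iff hα, ← hΘ, (hθ j hj).2]
    exact_mod_cast hexp j
  -- A point of phase `c + π` is not a zero.
  have hne : popuc α β (n + 1) ≠ 0 := by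
    intro h0
    obtain ⟨t, ht⟩ : c + Real.pi ∈ Set.range Θ := by
      obtain ⟨t, -, ht⟩ := intermediate_value_Icc (show (0 : ℝ) ≤ 2 * Real.pi + 2 * Real.pi by linarith)
        (continuous_pruferPhase hα n).continuousOn
        (show c + Real.pi ∈ Set.Icc _ _ from ⟨by linarith [hcm.1], by
          rw [pruferPhase_add_two_pi, ← hΘ, htot]
          have : (0 : ℝ) ≤ n * (2 * Real.pi) := by positivity
          linarith [hcm.2]⟩)
      exact ⟨t, ht⟩
    have h1 : (popuc α β (n + 1)).IsRoot (exp (t * I)) := by rw [h0]; simp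
    rw [isRoot_popuc_iff hα, ← hΘ, ht, ← hexp 0] at h1
    rw [show ((c + Real.pi : ℝ) : ℂ) * I = ((c + 2 * Real.pi * (0 : ℤ) : ℝ) : ℂ) * I + Real.pi * I by
      push_cast; ring, exp_add, exp_pi_mul_I, mul_neg, mul_one, neg_eq_self] at h1
    exact exp_ne_zero _ h1
  refine ⟨θ, fun j hj => ⟨Set.Ico_subset_Icc_self (hθ j hj).1, ?_⟩, ?_⟩
  · rw [(hθ j hj).2]
    exact abs_le.2 ⟨by linarith [hcm.1], by linarith [hcm.2]⟩
  · symm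
    -- These are `n + 1` distinct roots and the degree is at most `n + 1`, so they exhaust the roots
    -- and each is simple.
    refine Multiset.eq_of_le_of_card_le ?_ ?_
    · rw [Multiset.le_iff_subset]
      · intro z hz
        obtain ⟨j, hj, rfl⟩ := Multiset.mem_map.1 hz
        exact (Polynomial.mem_roots hne).2 (hroot j (Multiset.mem_range.1 hj))
      · refine Multiset.Nodup.map_on (fun i hi j hj hij => ?_) (Multiset.nodup_range _)
        rw [Multiset.mem_range] at hi hj
        have h1 := exp_mul_I_injOn_Ico 0 (by rw [zero_add]; exact (hθ i hi).1)
          (by rw [zero_add]; exact (hθ j hj).1) hij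
        have h2 := (hθ i hi).2
        rw [h1, (hθ j hj).2] at h2
        have h3 : (j : ℝ) = i := mul_left_cancel₀ Real.two_pi_pos.ne' (add_left_cancel h2)
        exact_mod_cast h3.symm
    · rw [Multiset.card_map, Multiset.card_range]
      exact (Polynomial.card_roots' _).trans (natDegree_popuc_le β n)

theorem isDensityOfZeros_popuc (hα : ∀ n, ‖α n‖ < 1)
    (hbv : Summable (fun n : ℕ => ‖α (n + 1) - α n‖))
    (hlim : Tendsto (fun n : ℕ => ‖α n‖) atTop (nhds 0)) {β : ℕ → ℂ} (hβ : ∀ n, ‖β n‖ = 1) :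
    IsDensityOfZeros (popuc α β) normalizedArcLength := by
  refine ⟨isProbabilityMeasure_normalizedArcLength, fun f => ?_⟩
  have hpi := Real.pi_pos
  rw [integral_normalizedArcLength f.continuous.measurable, ← tendsto_add_atTop_iff_nat 1]
  set F : ℝ → ℝ := fun x => f (exp (x * I)) with hF
  have hFc : Continuous F := f.continuous.comp continuous_exp_ofReal_mul_I
  have hper : Function.Periodic F (2 * Real.pi) := fun x => by
    simp only [hF, exp_add_two_pi_mul_I]
  have hint := hper.intervalIntegral_add_eq (-Real.pi) 0
  rw [show -Real.pi + 2 * Real.pi = Real.pi by ring, zero_add] at hint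
  rw [hint, Metric.tendsto_atTop]
  intro ε hε
  obtain ⟨δ, hδ, hFu⟩ := Metric.uniformContinuousOn_iff.1
    (isCompact_Icc.uniformContinuousOn_of_continuous
      (hFc.continuousOn (s := Set.Icc 0 (2 * Real.pi)))) (ε / 2) (half_pos hε)
  obtain ⟨N, hN⟩ := exists_abs_pruferPhase_sub_le hα hbv hlim (show 0 < δ / 4 by positivity)
  obtain ⟨N', hN'⟩ := exists_nat_ge (4 * Real.pi / (δ / 4))
  refine ⟨max N N', fun n hn => ?_⟩
  have hn' : (N' : ℝ) ≤ n := by exact_mod_cast (le_max_right _ _).trans hn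
  have hn0 : (0 : ℝ) < n + 1 := by positivity
  obtain ⟨θ, hθ, hroots⟩ := exists_roots_popuc_eq hα hβ n
  have hsmall : 4 * Real.pi ≤ δ / 4 * (n + 1) := by
    rw [← div_le_iff₀' (by positivity)]; linarith
  set b : ℕ → ℝ := fun j => 2 * Real.pi * j / (n + 1) with hb
  have hbd : ∀ j, b (j + 1) - b j = 2 * Real.pi / (n + 1) := fun j => by
    simp only [hb]; push_cast; field_simp; ring
  have hbn : ∀ j, (n + 1) * b j = 2 * Real.pi * j := fun j => by simp only [hb]; field_simp
  have hclose : ∀ j < n + 1, ∀ t ∈ Set.uIoc (b j) (b (j + 1)), ‖F (θ j) - F t‖ ≤ ε / 2 := by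
    intro j hj t ht
    have hjn : (j : ℝ) + 1 ≤ n + 1 := by exact_mod_cast hj
    have hblt : 0 < 2 * Real.pi / (n + 1) := by positivity
    rw [Set.uIoc_of_le (by linarith [hbd j])] at ht
    have hb0 : 0 ≤ b j := by positivity
    have hb1 : b (j + 1) ≤ 2 * Real.pi := by
      simp only [hb]; push_cast
      rw [div_le_iff₀ hn0]; gcongr
    refine (hFu (θ j) (hθ j hj).1 t ⟨by linarith [ht.1], by linarith [ht.2]⟩ ?_).le
    have h1 := abs_le.1 (hN n ((le_max_left _ _).trans hn) (θ j) (hθ j hj).1)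
    have h2 := abs_le.1 (hθ j hj).2
    have h3 : (n + 1) * b j ≤ (n + 1) * t := by gcongr; exact ht.1.le
    have h4 : (n + 1) * t ≤ (n + 1) * b (j + 1) := by gcongr; exact ht.2
    rw [hbn] at h3 h4
    push_cast at h4
    -- Phase error `(δ / 4)(n + 1)`, offset of the level `2π` and cell width `2π` add up to at most
    -- `(δ / 2)(n + 1)`.
    have h5 : |(n + 1) * (θ j - t)| < (n + 1) * δ := by
      have : 0 < δ * (n + 1) := by positivity
      exact abs_lt.2 ⟨by linarith, by linarith⟩
    rw [abs_mul, abs_of_pos hn0] at h5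
    exact lt_of_mul_lt_mul_left h5 hn0.le
  have hsum : ∫ x in (0 : ℝ)..2 * Real.pi, F x =
      ∑ j ∈ Finset.range (n + 1), ∫ x in b j..b (j + 1), F x := by
    rw [intervalIntegral.sum_integral_adjacent_intervals fun k _ => hFc.intervalIntegrable _ _]
    congr 1
    · simp [hb]
    · simp only [hb]; push_cast; field_simp
  have hroot : (((popuc α β (n + 1)).roots.map fun z => f z).sum : ℝ) =
      ∑ j ∈ Finset.range (n + 1), F (θ j) := by
    rw [hroots, Multiset.map_map]; rfl
  have hterm : ∀ j ∈ Finset.range (n + 1),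
      ‖(2 * Real.pi / (n + 1)) * F (θ j) - ∫ x in b j..b (j + 1), F x‖ ≤
        ε / 2 * (2 * Real.pi / (n + 1)) := by
    intro j hj
    have h1 : (2 * Real.pi / (n + 1)) * F (θ j) - ∫ x in b j..b (j + 1), F x =
        ∫ x in b j..b (j + 1), (F (θ j) - F x) := by
      rw [intervalIntegral.integral_sub intervalIntegrable_const (hFc.intervalIntegrable _ _),
        intervalIntegral.integral_const, hbd, smul_eq_mul]
    rw [h1]
    refine (intervalIntegral.norm_integral_le_of_norm_le_const
      (hclose j (Finset.mem_range.1 hj))).trans_eq ?_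
    rw [hbd, abs_of_pos (by positivity)]
  have htotal := norm_sum_le_of_le _ hterm
  rw [Finset.sum_sub_distrib, ← hsum, ← Finset.mul_sum, Finset.sum_const, Finset.card_range,
    nsmul_eq_mul] at htotal
  rw [hroot, Real.dist_eq]
  have h6 : (∑ j ∈ Finset.range (n + 1), F (θ j)) / ((n + 1 : ℕ) : ℝ) -
      (2 * Real.pi)⁻¹ * ∫ x in (0 : ℝ)..2 * Real.pi, F x =
      (2 * Real.pi)⁻¹ * (2 * Real.pi / (n + 1) * ∑ j ∈ Finset.range (n + 1), F (θ j) -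
        ∫ x in (0 : ℝ)..2 * Real.pi, F x) := by
    push_cast; field_simp
  rw [h6, abs_mul, abs_of_pos (by positivity)]
  calc _ ≤ (2 * Real.pi)⁻¹ * (((n + 1 : ℕ) : ℝ) * (ε / 2 * (2 * Real.pi / (n + 1)))) := by
        gcongr; exact htotal
    _ = ε / 2 := by push_cast; field_simp
    _ < ε := half_lt_self hε

end Density

theorem theorem10p1 (α : ℕ → ℂ) (hα : ∀ n, ‖α n‖ < 1)
    (hbv : Summable (fun n : ℕ => ‖α (n + 1) - α n‖))
    (hlim : Filter.Tendsto (fun n : ℕ => ‖α n‖) Filter.atTop (nhds 0))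
    (β : ℕ → ℂ) (hβ : ∀ n, ‖β n‖ = 1)
    (K : Set ℂ) (hK : IsCompact K) (hK1 : K ⊆ Metric.sphere (0 : ℂ) 1 \ {1}) :
    UniformClockBehavior (popuc α β) normalizedArcLength K := by
  have hpi := Real.pi_pos
  refine ⟨isDensityOfZeros_popuc hα hbv hlim hβ, fun _ => (2 * Real.pi)⁻¹, fun z hz =>
    hasArcDensityAt_normalizedArcLength (by simpa using (hK1 hz).1), continuousOn_const,
    fun _ _ => by positivity, fun ε hε => ?_⟩
  -- Being closed and missing `1`, `K` keeps a positive distance `d` from it.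
  obtain ⟨d, hd, hdK⟩ := Metric.isOpen_iff.1 hK.isClosed.isOpen_compl 1
    (fun h => (hK1 h).2 rfl)
  obtain ⟨N, hN⟩ := exists_abs_gap_sub_le hα hbv hlim β hd hε
  refine ⟨N + 1, fun n hn θ θ' hθ _ hs => ?_⟩
  obtain ⟨m, rfl⟩ : ∃ m, n = m + 1 := ⟨n - 1, by omega⟩
  rw [inv_inv]
  push_cast
  refine hN m (by omega) θ θ' ?_ hs
  by_contra hlt
  exact hdK (by rw [Metric.mem_ball, dist_eq_norm]; exact not_le.1 hlt) hθ
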